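/- Formulas are built from propositional variables $p_0, p_1, p_2, \dots$ and the constant $\bot$ by means of the connectives $\to$, $\Box$ and $\Box^+$; put $\neg A := A \to \bot$ and $A \wedge B := \neg(A \to \neg B)$. The logic $\mathsf{K}^+$ is given by the axioms (i) all classical propositional tautologies (in this modal language, where variables and formulas of the form $\Box A$, $\Box^+ A$ are treated as atoms); (ii) $\Box(A \to B) \to (\Box A \to \Box B)$; (iii) $\Box^+(A \to B) \to (\Box^+ A \to \Box^+ B)$; (iv) $\Box^+ A \to (\Box A \wedge \Box\Box^+ A)$; (v) $(\Box A \wedge \Box^+(A \to \Box A)) \to \Box^+ A$; and the inference rules: from $A$ and $A \to B$ infer $B$; from $A$ infer $\Box^+ A$. Write $\mathsf{K}^+ \vdash A$ if $A$ is provable in this calculus. **Corollary (admissibility of $\omega$).** The infinitary inference rule ($\omega$), which derives $B_0 \to \Box^+ A$ from the countably many premises $B_i \to \Box(A \wedge B_{i+1})$, $i \in \mathbb{N}$, is admissible in $\mathsf{K}^+$. That is, for every formula $A$ and every sequence of formulas $(B_i)_{i \in \mathbb{N}}$, if $\mathsf{K}^+ \vdash B_i \to \Box(A \wedge B_{i+1})$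 for all $i \in \mathbb{N}$, then $\mathsf{K}^+ \vdash B_0 \to \Box^+ A$. -/

import Mathlib

namespace KPlus

/-- Formulas of the modal logic of transitive closure, built from propositional variables
`p_0, p_1, …` and the constant `⊥` by means of `→`, `□` and `□⁺`. -/
inductive Fm : Type
  | var : ℕ → Fm
  | bot : Fm
  | imp : Fm → Fm → Fm
  | box : Fm → Fm
  | boxPlus : Fm → Fm

namespace Fm

/-- Negation, `¬A := A → ⊥`. -/
def neg (A : Fm) : Fm := A.imp bot

/-- Conjunction, `A ∧ B := ¬(A → ¬B)`. -/
def conj (A B : Fm) : Fm := (A.imp B.neg).neg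

/-- The truth value of a formula under a Boolean assignment `v`, where `⊥` and `→` are read
classically and the variables and the formulas `□A`, `□⁺A` are treated as atoms. -/
def boolEval (v : Fm → Bool) : Fm → Bool
  | var n => v (var n)
  | bot => false
  | imp A B => !boolEval v A || boolEval v B
  | box A => v (box A)
  | boxPlus A => v (boxPlus A)

/-- `A` is a tautology of classical propositional logic (in the modal language). -/
def IsTautology (A : Fm) : Prop := ∀ v : Fm → Bool, boolEval v A = true

end Fm

/-- `Provable A` means that `A` is a theorem of the Frege-Hilbert calculus of the logic `K⁺`. -/
inductive Provable : Fm → Prop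
  | taut {A : Fm} : A.IsTautology → Provable A
  | boxK (A B : Fm) : Provable ((A.imp B).box.imp (A.box.imp B.box))
  | boxPlusK (A B : Fm) : Provable ((A.imp B).boxPlus.imp (A.boxPlus.imp B.boxPlus))
  | unfold (A : Fm) : Provable (A.boxPlus.imp (A.box.conj A.boxPlus.box))
  | induct (A : Fm) : Provable ((A.box.conj (A.imp A.box).boxPlus).imp A.boxPlus)
  | mp {A B : Fm} : Provable A → Provable (A.imp B) → Provable B
  | nec {A : Fm} : Provable A → Provable A.boxPlus

/-- An inference rule, given by its instances: `R P C` says that the formula `C` may be inferred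
from the (possibly infinite) set of premises `P`. -/
abbrev InferenceRule : Type := Set Fm → Fm → Prop

/-- The rule `(ω)`: from `B_i → □(A ∧ B_{i+1})` for all `i ∈ ℕ` infer `B_0 → □⁺A`. -/
inductive omegaRule : InferenceRule
  | intro (A : Fm) (B : ℕ → Fm) :
      omegaRule (Set.range fun i => (B i).imp (A.conj (B (i + 1))).box) ((B 0).imp A.boxPlus)

/-- A rule is admissible in `K⁺` if, for every instance of it, the conclusion is provable in `K⁺`
whenever all premises are provable in `K⁺`. -/
def Admissible (R : InferenceRule) : Prop :=
  ∀ (P : Set Fm) (C : Fm), R P C → (∀ X ∈ P, Provable X) → Provable C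

end KPlus

/-! In a Kripke model where `□⁺` is read over the transitive closure of `R`, the premises of `(ω)`
push `B_i` to `B_{i+1}` along every `R`-path from a `B_0`-world and make `A` true at each step; so
the rule preserves truth (`sat_boxPlus_of_chain`). Soundness and completeness transfer this to
provability. For completeness, the canonical relation is filtered through a finite list of formulas.
The worlds reachable in the filtration are then definable by one formula, to which the induction
axiom applies (`mem_boxPlus_filtRel`). -/

namespace KPlus

/-! ### Kripke semantics and soundness -/

/-- Satisfaction in a Kripke model, with `□⁺` interpreted by the transitive closure of `R`. -/
def Sat {W : Type*} (R : W → W → Prop) (V : W → ℕ → Prop) : W → Fm → Prop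
  | w, .var n => V w n
  | _, .bot => False
  | w, .imp A B => Sat R V w A → Sat R V w B
  | w, .box A => ∀ u, R w u → Sat R V u A
  | w, .boxPlus A => ∀ u, Relation.TransGen R w u → Sat R V u A

section Soundness

variable {W : Type*} {R : W → W → Prop} {V : W → ℕ → Prop}

theorem sat_conj {w : W} {A B : Fm} :
    Sat R V w (A.conj B) ↔ Sat R V w A ∧ Sat R V w B := by
  simp only [Fm.conj, Fm.neg, Sat]
  tauto

open Classical in
theorem boolEval_sat (w : W) (A : Fm) :
    A.boolEval (fun B => decide (Sat R V w B)) = true ↔ Sat R V w A := by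
  induction A with
  | var n => simp [Fm.boolEval]
  | bot => simp [Fm.boolEval, Sat]
  | imp A B ihA ihB =>
    rw [Fm.boolEval, Sat, ← ihA, ← ihB, Bool.or_eq_true, Bool.not_eq_true', ← Bool.not_eq_true]
    tauto
  | box A => simp [Fm.boolEval]
  | boxPlus A => simp [Fm.boolEval]

theorem Provable.sat {A : Fm} (h : Provable A) (w : W) : Sat R V w A := by
  classical
  induction h generalizing w with
  | taut h => exact (boolEval_sat w _).1 (h _)
  | boxK A B => exact fun h h' u hu => h u hu (h' u hu)
  | boxPlusK A B => exact fun h h' u hu => h u hu (h' u hu)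
  | unfold A =>
    exact fun h => sat_conj.2 ⟨fun u hu => h u (.single hu), fun u hu x hx => h x (.head hu hx)⟩
  | induct A =>
    intro h u hu
    obtain ⟨h₁, h₂⟩ := sat_conj.1 h
    induction hu with
    | single hu => exact h₁ _ hu
    | tail hu hx ih => exact h₂ _ hu ih _ hx
  | mp _ _ ihA ihAB => exact ihAB w (ihA w)
  | nec _ ih => exact fun u _ => ih u

/-- The rule `(ω)` preserves truth in every Kripke model. -/
theorem sat_boxPlus_of_chain {A : Fm} {B : ℕ → Fm}
    (h : ∀ i w, Sat R V w ((B i).imp (A.conj (B (i + 1))).box)) (w : W) :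
    Sat R V w ((B 0).imp A.boxPlus) := by
  intro hw u hu
  suffices H : Sat R V u A ∧ ∃ i, Sat R V u (B i) from H.1
  induction hu with
  | single hu =>
    obtain ⟨hA, hB⟩ := sat_conj.1 (h 0 w hw _ hu)
    exact ⟨hA, 1, hB⟩
  | tail _ hx ih =>
    obtain ⟨_, i, hi⟩ := ih
    obtain ⟨hA, hB⟩ := sat_conj.1 (h i _ hi _ hx)
    exact ⟨hA, i + 1, hB⟩

end Soundness

/-! ### Theories and prime theories -/

/-- A set of formulas that contains all theorems and is closed under modus ponens. -/
structure IsTheory (T : Set Fm) : Prop where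
  provable : ∀ {A}, Provable A → A ∈ T
  mp : ∀ {A B}, A ∈ T → A.imp B ∈ T → B ∈ T

/-- Maximal consistent theories. -/
structure World where
  carrier : Set Fm
  isTheory : IsTheory carrier
  bot_notMem : Fm.bot ∉ carrier
  imp_mem : ∀ {A B}, (A ∈ carrier → B ∈ carrier) → A.imp B ∈ carrier

instance : Membership Fm World := ⟨fun w A => A ∈ w.carrier⟩

namespace World

theorem mem_of_provable (w : World) {A : Fm} (h : Provable A) : A ∈ w := w.isTheory.provable h

theorem notMem_bot (w : World) : Fm.bot ∉ w := w.bot_notMem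

theorem mem_imp (w : World) {A B : Fm} : A.imp B ∈ w ↔ (A ∈ w → B ∈ w) :=
  ⟨fun h h' => w.isTheory.mp h' h, w.imp_mem⟩

theorem mem_neg (w : World) {A : Fm} : A.neg ∈ w ↔ A ∉ w := by
  simp only [Fm.neg, mem_imp, notMem_bot, imp_false]

theorem mem_conj (w : World) {A B : Fm} : A.conj B ∈ w ↔ A ∈ w ∧ B ∈ w := by
  simp only [Fm.conj, mem_neg, mem_imp]
  tauto

end World

theorem isTheory_provable : IsTheory {A | Provable A} := ⟨id, Provable.mp⟩

theorem IsTheory.sUnion {c : Set (Set Fm)} (hc : IsChain (· ⊆ ·) c) (hne : c.Nonempty)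
    (h : ∀ T ∈ c, IsTheory T) : IsTheory (⋃₀ c) where
  provable hA := let ⟨T, hT⟩ := hne; ⟨T, hT, (h T hT).provable hA⟩
  mp := by
    rintro A B ⟨T, hT, hA⟩ ⟨U, hU, hAB⟩
    rcases hc.total hT hU with hTU | hUT
    · exact ⟨U, hU, (h U hU).mp (hTU hA) hAB⟩
    · exact ⟨T, hT, (h T hT).mp hA (hUT hAB)⟩

/-- Adjoining the hypothesis `B` to a theory yields a theory. -/
theorem IsTheory.adjoin {T : Set Fm} (h : IsTheory T) (B : Fm) : IsTheory {C | B.imp C ∈ T} where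
  provable {A} hA := h.mp (h.provable hA) <| h.provable <| .taut fun v => by
    simp only [Fm.boolEval]
    cases A.boolEval v <;> cases B.boolEval v <;> rfl
  mp {A C} hA hAC := h.mp hAC <| h.mp hA <| h.provable <| .taut fun v => by
    simp only [Fm.boolEval]
    cases A.boolEval v <;> cases B.boolEval v <;> cases C.boolEval v <;> rfl

/-- Lindenbaum's lemma. -/
theorem IsTheory.exists_world {T : Set Fm} (hT : IsTheory T) {A : Fm} (hA : A ∉ T) :
    ∃ w : World, (∀ B ∈ T, B ∈ w) ∧ A ∉ w := by
  obtain ⟨M, hTM, hM⟩ := zorn_subset_nonempty {U | IsTheory U ∧ A ∉ U}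
    (fun c hcS hc hne => ⟨⋃₀ c, ⟨IsTheory.sUnion hc hne fun U hU => (hcS hU).1,
      fun ⟨U, hU, hAU⟩ => (hcS hU).2 hAU⟩, fun _ => Set.subset_sUnion_of_mem⟩) T ⟨hT, hA⟩
  obtain ⟨hMT, hAM⟩ := hM.prop
  have key : ∀ B, B ∉ M → B.imp A ∈ M := by
    intro B hB
    by_contra hBA
    have hle : M ⊆ {C | B.imp C ∈ M} := fun C hC =>
      hMT.mp hC <| hMT.provable <| .taut fun v => by
        simp only [Fm.boolEval]
        cases B.boolEval v <;> cases C.boolEval v <;> rfl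
    refine hB (hM.le_of_ge ⟨hMT.adjoin B, hBA⟩ hle ?_)
    exact hMT.provable <| .taut fun v => by
      simp only [Fm.boolEval]
      cases B.boolEval v <;> rfl
  refine ⟨⟨M, hMT, fun hbot => hAM ?_, fun {B C} hBC => ?_⟩, hTM, hAM⟩
  · exact hMT.mp hbot <| hMT.provable <| .taut fun v => by simp [Fm.boolEval]
  · by_cases hB : B ∈ M
    · exact hMT.mp (hBC hB) <| hMT.provable <| .taut fun v => by
        simp only [Fm.boolEval]
        cases B.boolEval v <;> cases C.boolEval v <;> rfl
    · by_contra hC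
      -- Both `B` and `B → C` imply `A` in `M`, and one of the two always holds classically.
      refine hAM <| hMT.mp (key _ hC) <| hMT.mp (key _ hB) <| hMT.provable <| .taut fun v => ?_
      simp only [Fm.boolEval]
      cases A.boolEval v <;> cases B.boolEval v <;> cases C.boolEval v <;> rfl

theorem provable_of_forall_mem {A : Fm} (h : ∀ w : World, A ∈ w) : Provable A := by
  by_contra hA
  obtain ⟨w, -, hw⟩ := isTheory_provable.exists_world hA
  exact hw (h w)

/-- Necessitation for `□` is not a rule of the calculus; it comes from that for `□⁺` and `unfold`.
-/
theorem Provable.box {A : Fm} (h : Provable A) : Provable A.box :=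
  provable_of_forall_mem fun w =>
    (w.mem_conj.1 (w.mem_imp.1 (w.mem_of_provable (.unfold A)) (w.mem_of_provable h.nec))).1

namespace World

/-- The accessibility relation of the canonical model. -/
def Rel (w u : World) : Prop := ∀ A, A.box ∈ w → A ∈ u

theorem mem_box (w : World) {A : Fm} : A.box ∈ w ↔ ∀ u, w.Rel u → A ∈ u := by
  refine ⟨fun h u hu => hu A h, fun h => ?_⟩
  by_contra hA
  have hT : IsTheory {C | C.box ∈ w} :=
    ⟨fun hC => w.mem_of_provable hC.box, fun {C D} hC hCD =>
      w.mem_imp.1 (w.mem_imp.1 (w.mem_of_provable (.boxK C D)) hCD) hC⟩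
  obtain ⟨u, hu, hAu⟩ := hT.exists_world hA
  exact hAu (h u hu)

theorem box_mem_of_boxPlus_mem {w : World} {A : Fm} (h : A.boxPlus ∈ w) :
    A.box ∈ w ∧ A.boxPlus.box ∈ w :=
  w.mem_conj.1 (w.mem_imp.1 (w.mem_of_provable (.unfold A)) h)

/-- If `S` is provably closed under `□` and implies `A`, then `□S` implies `□⁺A`. -/
theorem boxPlus_mem_of_invariant {w : World} {S A : Fm} (hS : Provable (S.imp S.box))
    (hSA : Provable (S.imp A)) (h : S.box ∈ w) : A.boxPlus ∈ w := by
  have hw : S.boxPlus ∈ w := w.mem_imp.1 (w.mem_of_provable (.induct S))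
    (w.mem_conj.2 ⟨h, w.mem_of_provable hS.nec⟩)
  exact w.mem_imp.1 (w.mem_imp.1 (w.mem_of_provable (.boxPlusK S A)) (w.mem_of_provable hSA.nec)) hw

/-! ### Filtration -/

/-- Two worlds agree on all formulas from the list `L`. -/
def Agree (L : List Fm) (w u : World) : Prop := ∀ A ∈ L, A ∈ w ↔ A ∈ u

theorem Agree.refl (L : List Fm) (w : World) : Agree L w w := fun _ _ => Iff.rfl

theorem Agree.symm {L : List Fm} {w u : World} (h : Agree L w u) : Agree L u w :=
  fun A hA => (h A hA).symm

theorem Agree.trans {L : List Fm} {w u x : World} (h : Agree L w u) (h' : Agree L u x) :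
    Agree L w x := fun A hA => (h A hA).trans (h' A hA)

/-- A set of worlds that depends only on the formulas in a finite list is definable. -/
theorem exists_definition (L : List Fm) (S : Set World)
    (hS : ∀ w u, Agree L w u → w ∈ S → u ∈ S) : ∃ D : Fm, ∀ w : World, D ∈ w ↔ w ∈ S := by
  induction L generalizing S with
  | nil =>
    have hS' : ∀ w u, w ∈ S → u ∈ S := fun w u => hS w u (by simp [Agree])
    by_cases h : S.Nonempty
    · obtain ⟨x, hx⟩ := h
      refine ⟨Fm.bot.neg, fun w => ?_⟩
      simp [mem_neg, notMem_bot, hS' x w hx]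
    · refine ⟨Fm.bot, fun w => ?_⟩
      simp [notMem_bot, Set.not_nonempty_iff_eq_empty.1 h]
  | cons A L ih =>
    -- `S` itself need not be invariant under agreement on the shorter list, so its two parts, split
    -- by `A`, are saturated first.
    obtain ⟨D₁, h₁⟩ := ih {w | ∃ u ∈ S, Agree L w u ∧ A ∈ u}
      fun w u hwu ⟨x, hx, hwx, hA⟩ => ⟨x, hx, hwu.symm.trans hwx, hA⟩
    obtain ⟨D₀, h₀⟩ := ih {w | ∃ u ∈ S, Agree L w u ∧ A ∉ u}
      fun w u hwu ⟨x, hx, hwx, hA⟩ => ⟨x, hx, hwu.symm.trans hwx, hA⟩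
    refine ⟨(A.imp D₁).conj (A.neg.imp D₀), fun w => ?_⟩
    rw [mem_conj, mem_imp, mem_imp, mem_neg, h₁, h₀]
    constructor
    · rintro ⟨h, h'⟩
      by_cases hA : A ∈ w
      · obtain ⟨u, hu, hwu, hAu⟩ := h hA
        exact hS u w (List.forall_mem_cons.2 ⟨iff_of_true hAu hA, hwu.symm⟩) hu
      · obtain ⟨u, hu, hwu, hAu⟩ := h' hA
        exact hS u w (List.forall_mem_cons.2 ⟨iff_of_false hAu hA, hwu.symm⟩) hu
    · exact fun hw => ⟨fun hA => ⟨w, hw, .refl L w, hA⟩, fun hA => ⟨w, hw, .refl L w, hA⟩⟩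

/-- The smallest filtration of the canonical relation through `L`. -/
def FiltRel (L : List Fm) (w u : World) : Prop :=
  ∃ w' u', Agree L w w' ∧ Agree L u u' ∧ w'.Rel u'

theorem Rel.filtRel {w u : World} (L : List Fm) (h : w.Rel u) : FiltRel L w u :=
  ⟨w, u, .refl L w, .refl L u, h⟩

theorem FiltRel.congr_right {L : List Fm} {w u x : World} (h : FiltRel L w u) (hux : Agree L u x) :
    FiltRel L w x :=
  let ⟨w', u', hw, hu, hR⟩ := h
  ⟨w', u', hw, hux.symm.trans hu, hR⟩

theorem transGen_filtRel_congr_right {L : List Fm} {w u x : World}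
    (h : Relation.TransGen (FiltRel L) w u) (hux : Agree L u x) :
    Relation.TransGen (FiltRel L) w x := by
  cases h with
  | single h => exact .single (h.congr_right hux)
  | tail h h' => exact .tail h (h'.congr_right hux)

theorem mem_box_filtRel {L : List Fm} {A : Fm} (hb : A.box ∈ L) (hA : A ∈ L) (w : World) :
    A.box ∈ w ↔ ∀ u, FiltRel L w u → A ∈ u := by
  refine ⟨?_, fun h => w.mem_box.2 fun u hu => h u (hu.filtRel L)⟩
  rintro h u ⟨w', u', hw, hu, hR⟩
  exact (hu A hA).2 (hR A ((hw _ hb).1 h))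

theorem mem_boxPlus_filtRel {L : List Fm} {A : Fm} (hb : A.boxPlus ∈ L) (hA : A ∈ L) (w : World) :
    A.boxPlus ∈ w ↔ ∀ u, Relation.TransGen (FiltRel L) w u → A ∈ u := by
  constructor
  -- `□□⁺A` need not be in `L`; carrying `□⁺A`, which is, along the path suffices.
  · have step : ∀ {x y}, A.boxPlus ∈ x → FiltRel L x y → A ∈ y ∧ A.boxPlus ∈ y := by
      rintro x y hx ⟨x', y', hxx, hyy, hR⟩
      obtain ⟨h₁, h₂⟩ := box_mem_of_boxPlus_mem ((hxx _ hb).1 hx)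
      exact ⟨(hyy _ hA).2 (hR _ h₁), (hyy _ hb).2 (hR _ h₂)⟩
    intro h u hu
    suffices H : A ∈ u ∧ A.boxPlus ∈ u from H.1
    induction hu with
    | single hu => exact step h hu
    | tail _ hx ih => exact step ih.2 hx
  · intro h
    -- `S` defines the worlds reachable from `w`: it is closed under `□` and, by `h`, implies `A`.
    obtain ⟨S, hS⟩ := exists_definition L {u | Relation.TransGen (FiltRel L) w u}
      fun x y hxy hx => transGen_filtRel_congr_right hx hxy
    refine boxPlus_mem_of_invariant (S := S) (provable_of_forall_mem fun x => ?_)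
      (provable_of_forall_mem fun x => ?_) (w.mem_box.2 fun u hu => ?_)
    · exact x.mem_imp.2 fun hx => x.mem_box.2 fun y hy =>
        (hS y).2 (.tail ((hS x).1 hx) (hy.filtRel L))
    · exact x.mem_imp.2 fun hx => h x ((hS x).1 hx)
    · exact (hS u).2 (.single (hu.filtRel L))

end World

/-! ### Completeness and admissibility of `(ω)` -/

/-- The list of subformulas of a formula. -/
def Fm.subformulas : Fm → List Fm
  | var n => [var n]
  | bot => [bot]
  | imp A B => imp A B :: (A.subformulas ++ B.subformulas)
  | box A => box A :: A.subformulas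
  | boxPlus A => boxPlus A :: A.subformulas

theorem Fm.mem_subformulas_self (A : Fm) : A ∈ A.subformulas := by
  cases A <;> simp [subformulas]

/-- Truth lemma for the filtration; no quotient is taken, since only the relation changes. -/
theorem World.sat_iff_mem {L : List Fm} (A : Fm) (hL : A.subformulas ⊆ L) (w : World) :
    Sat (FiltRel L) (fun u n => Fm.var n ∈ u) w A ↔ A ∈ w := by
  induction A generalizing w with
  | var n => rfl
  | bot => exact iff_of_false id w.notMem_bot
  | imp A B ihA ihB =>
    simp only [Fm.subformulas, List.cons_subset, List.append_subset] at hL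
    rw [Sat, w.mem_imp, ihA hL.2.1, ihB hL.2.2]
  | box A ih =>
    obtain ⟨hb, hL⟩ := List.cons_subset.1 hL
    simp only [Sat, ih hL, mem_box_filtRel hb (hL A.mem_subformulas_self) w]
  | boxPlus A ih =>
    obtain ⟨hb, hL⟩ := List.cons_subset.1 hL
    simp only [Sat, ih hL, mem_boxPlus_filtRel hb (hL A.mem_subformulas_self) w]

/-- Kripke completeness of `K⁺`. -/
theorem provable_of_valid {A : Fm}
    (h : ∀ (W : Type) (R : W → W → Prop) (V : W → ℕ → Prop) (w : W), Sat R V w A) : Provable A :=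
  provable_of_forall_mem fun w => (w.sat_iff_mem A (List.Subset.refl _)).1 (h _ _ _ w)

end KPlus

theorem mainTheorem8 : KPlus.Admissible KPlus.omegaRule := by
  rintro _ _ ⟨A, B⟩ h
  exact KPlus.provable_of_valid fun W R V =>
    KPlus.sat_boxPlus_of_chain fun i => (h _ (Set.mem_range_self i)).sat
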